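/- Let $\langle A \mid R\rangle$ be a finite monoid presentation of a monoid $M$. An elementary transformation replaces, in a word over $A$, one occurrence of one side of a relation of $R$ by the other side. For words $u,v\in A^*$ that are equal in $M$, let $\partial_M(u,v)$ be the length of a shortest sequence of elementary transformations that transforms $u$ into $v$. The Dehn function of the presentation is $$\partial_M(n)=\max\{\partial_M(u,v) : u,v\in A^*,\ u=v \text{ in } M,\ |u|+|v|\le n\}.$$ For $\varphi,\psi\colon\mathbb N\to\mathbb R$ write $\varphi\preceq\psi$ (equivalently $\psi\succeq\varphi$) if there is a constant $c\in\mathbb N$ such that $\varphi(n)\le c\,\psi(cn)+cn$ for all integers $n\ge 1$. **Theorem.** For every integer $N\ge 2$, the Dehn function $\partial_N$ of the one-relation monoid $$\Pi_N=\mathrm{Mon}\langle a,b \mid baa(ba)^N=a\rangle$$ satisfies $\partial_N(n)\succeq N^{n/4}$. In particular it is at least exponential, that is, $\partial_N(n)\succeq 2^n$. Consequently, the question of Cain and Maltcev whether every monoid $\mathrm{Mon}\langle a,b\mid bUa=a\rangle$, with $U$ a word over $\{a,b\}$, has at most quadratic Dehn function (that is, a Dehn function $\preceq n^2$) has a negative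 answer. -/

import Mathlib

namespace MonoidDehn

section General

variable {α : Type*}

/-- An elementary transformation of the presentation `Mon⟨α | R⟩`: one occurrence of one side of a
defining relation, inside a word over `α`, is replaced by the other side. -/
def Step (R : FreeMonoid α → FreeMonoid α → Prop) (u v : FreeMonoid α) : Prop :=
  ∃ p q l r : FreeMonoid α, (R l r ∨ R r l) ∧ u = p * l * q ∧ v = p * r * q

/-- `Derivation R k u v`: some sequence of exactly `k` elementary transformations transforms the
word `u` into the word `v`. -/
inductive Derivation (R : FreeMonoid α → FreeMonoid α → Prop) :
    ℕ → FreeMonoid α → FreeMonoid α → Prop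
  | refl (u : FreeMonoid α) : Derivation R 0 u u
  | step {k : ℕ} {u v w : FreeMonoid α} (h : Step R u v) (t : Derivation R k v w) :
      Derivation R (k + 1) u w

/-- The words `u` and `v` represent the same element of the monoid `Mon⟨α | R⟩`. -/
def EqIn (R : FreeMonoid α → FreeMonoid α → Prop) (u v : FreeMonoid α) : Prop :=
  PresentedMonoid.mk R u = PresentedMonoid.mk R v

/-- The length of a shortest sequence of elementary transformations from `u` to `v`. It is only
used when `u` and `v` are equal in `Mon⟨α | R⟩`; such a sequence then exists
(see `eqIn_iff_exists_derivation`). -/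
noncomputable def derivationDist (R : FreeMonoid α → FreeMonoid α → Prop)
    (u v : FreeMonoid α) : ℕ :=
  sInf {k : ℕ | Derivation R k u v}

/-- The distances `derivationDist R u v` of all pairs of words `u`, `v` that are equal in
`Mon⟨α | R⟩` and satisfy `|u| + |v| ≤ n`. -/
def dehnSet (R : FreeMonoid α → FreeMonoid α → Prop) (n : ℕ) : Set ℕ :=
  {d : ℕ | ∃ u v : FreeMonoid α,
    EqIn R u v ∧ u.length + v.length ≤ n ∧ d = derivationDist R u v}

/-- The Dehn function of `Mon⟨α | R⟩`: the maximum of `dehnSet R n`. Over a finite alphabet this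
maximum exists (see `isGreatest_dehnFunction`). -/
noncomputable def dehnFunction (R : FreeMonoid α → FreeMonoid α → Prop) (n : ℕ) : ℕ :=
  sSup (dehnSet R n)

theorem Derivation.trans {R : FreeMonoid α → FreeMonoid α → Prop} {j k : ℕ}
    {u v w : FreeMonoid α} (h₁ : Derivation R j u v) (h₂ : Derivation R k v w) :
    ∃ m, Derivation R m u w := by
  induction h₁ with
  | refl u => exact ⟨k, h₂⟩
  | step h _ ih =>
    obtain ⟨m, hm⟩ := ih h₂
    exact ⟨m + 1, .step h hm⟩

theorem Derivation.symm {R : FreeMonoid α → FreeMonoid α → Prop} {k : ℕ}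
    {u v : FreeMonoid α} (h : Derivation R k u v) : ∃ m, Derivation R m v u := by
  induction h with
  | refl u => exact ⟨0, .refl u⟩
  | step h _ ih =>
    obtain ⟨m, hm⟩ := ih
    obtain ⟨p, q, l, r, hR, hu, hv⟩ := h
    exact hm.trans (.step ⟨p, q, r, l, hR.symm, hv, hu⟩ (.refl _))

theorem Derivation.congr {R : FreeMonoid α → FreeMonoid α → Prop} {k : ℕ}
    {u v : FreeMonoid α} (h : Derivation R k u v) (x y : FreeMonoid α) :
    Derivation R k (x * u * y) (x * v * y) := by
  induction h with
  | refl u => exact .refl _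
  | step h _ ih =>
    obtain ⟨p, q, l, r, hR, hu, hv⟩ := h
    refine .step ⟨x * p, q * y, l, r, hR, ?_, ?_⟩ ih
    · simp only [hu, mul_assoc]
    · simp only [hv, mul_assoc]

/-- Two words are equal in `Mon⟨α | R⟩` if and only if a sequence of elementary transformations
connects them. -/
theorem eqIn_iff_exists_derivation (R : FreeMonoid α → FreeMonoid α → Prop)
    (u v : FreeMonoid α) : EqIn R u v ↔ ∃ k, Derivation R k u v := by
  constructor
  · intro h
    have h' : conGen R u v := Quotient.exact h
    have h'' : ConGen.Rel R u v := h'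
    induction h'' with
    | of x y hxy => exact ⟨1, .step ⟨1, 1, x, y, Or.inl hxy, by simp, by simp⟩ (.refl _)⟩
    | refl x => exact ⟨0, .refl x⟩
    | symm hxy ih =>
      obtain ⟨k, hk⟩ := ih (Quotient.sound hxy) hxy
      exact hk.symm
    | trans h₁ h₂ ih₁ ih₂ =>
      obtain ⟨j, hj⟩ := ih₁ (Quotient.sound h₁) h₁
      obtain ⟨k, hk⟩ := ih₂ (Quotient.sound h₂) h₂
      exact hj.trans hk
    | @mul w x y z h₁ h₂ ih₁ ih₂ =>
      obtain ⟨j, hj⟩ := ih₁ (Quotient.sound h₁) h₁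
      obtain ⟨k, hk⟩ := ih₂ (Quotient.sound h₂) h₂
      have e₁ := hj.congr 1 y
      have e₂ := hk.congr x 1
      simp only [one_mul, mul_one] at e₁ e₂
      exact e₁.trans e₂
  · rintro ⟨k, h⟩
    induction h with
    | refl u => rfl
    | step h _ ih =>
      refine Eq.trans ?_ ih
      obtain ⟨p, q, l, r, hR, rfl, rfl⟩ := h
      have e : PresentedMonoid.mk R l = PresentedMonoid.mk R r := by
        rcases hR with h | h
        · exact Quotient.sound (ConGen.Rel.of _ _ h)
        · exact (Quotient.sound (ConGen.Rel.of _ _ h)).symm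
      simp only [map_mul, e]

/-- Over a finite alphabet the maximum in the definition of the Dehn function is attained. -/
theorem isGreatest_dehnFunction [Finite α] (R : FreeMonoid α → FreeMonoid α → Prop) (n : ℕ) :
    IsGreatest (dehnSet R n) (dehnFunction R n) := by
  have hfin : {u : FreeMonoid α | u.length ≤ n}.Finite := List.finite_length_le α n
  have hsub : dehnSet R n ⊆ (fun p : FreeMonoid α × FreeMonoid α => derivationDist R p.1 p.2) ''
      ({u : FreeMonoid α | u.length ≤ n} ×ˢ {u : FreeMonoid α | u.length ≤ n}) := by
    rintro d ⟨u, v, -, hl, rfl⟩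
    refine ⟨(u, v), ⟨?_, ?_⟩, rfl⟩
    · show u.length ≤ n
      omega
    · show v.length ≤ n
      omega
  have hb : BddAbove (dehnSet R n) := (((hfin.prod hfin).image _).subset hsub).bddAbove
  have hne : (dehnSet R n).Nonempty := ⟨_, 1, 1, rfl, by simp, rfl⟩
  exact ⟨Nat.sSup_mem hne hb, fun d hd => le_csSup hb hd⟩

end General

/-- `φ ⪯ ψ`: there is a constant `c : ℕ` with `φ n ≤ c * ψ (c * n) + c * n` for all positive
integers `n`. -/
def GrowthLE (φ ψ : ℕ → ℝ) : Prop :=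
  ∃ c : ℕ, ∀ n : ℕ, 1 ≤ n → φ n ≤ c * ψ (c * n) + c * n

/-- The two-letter alphabet. -/
inductive Letter : Type
  | a
  | b

instance : Finite Letter :=
  Finite.of_surjective (fun t : Bool => if t then Letter.a else Letter.b) (by
    intro x
    cases x
    · exact ⟨true, rfl⟩
    · exact ⟨false, rfl⟩)

/-- The one-letter word `a`. -/
def wa : FreeMonoid Letter := FreeMonoid.of Letter.a

/-- The one-letter word `b`. -/
def wb : FreeMonoid Letter := FreeMonoid.of Letter.b

/-- The single defining relation `bUa = a` of the monadic one-relation monoid given by `U`. -/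
def monadicRel (U : FreeMonoid Letter) (l r : FreeMonoid Letter) : Prop :=
  l = wb * U * wa ∧ r = wa

/-- The single defining relation `baa(ba)^N = a` of the monoid `Π_N`. -/
def piRel (N : ℕ) (l r : FreeMonoid Letter) : Prop :=
  l = wb * wa * wa * (wb * wa) ^ N ∧ r = wa

end MonoidDehn

namespace MonoidDehn

/-! ### Positive consequences of the relation, and the equality of the two test words -/

section Equality

variable {M : Type*} [Monoid M] {A B : M} {N : ℕ}

/-! Let `a` lower a level by one, and let `b`, read at level `j`, raise it by one and move a
rational position by `(-N)^j`. Both sides of the relation act alike: an affine action of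
Baumslag–Solitar type. Weigh each `b` by `(-N)^j` if `j ≥ 0` and the position is an integer, and by
0 otherwise. The weights in a relator cancel except at level 0, where they leave at most 1
(`readWord_relator`), so the weight difference of two words bounds their distance from below.

The words `farLeft k` and `farRight k` have length linear in `k` and are equal in the monoid
(`mul_pow_mul_pow_mul_pow_eq`). Read from level `2k-1` and position 0, the first `b` of `farLeft k`
has weight `(-N)^(2k-1)`. Every other `b` of either word is read at level -1 or, after the shift by
`-1/N` made there, at a non-integer position, and weighs nothing. Hence the distance is at least
`N^(2k-1)`. -/

theorem pow_mul_mul_pow_eq (h : B * A * A * (B * A) ^ N = A) (k : ℕ) :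
    (B * A) ^ k * A * (B * A) ^ (N * k) = A := by
  induction k with
  | zero => simp
  | succ k ih =>
    calc (B * A) ^ (k + 1) * A * (B * A) ^ (N * (k + 1))
        = (B * A) ^ k * (B * A * A * (B * A) ^ N) * (B * A) ^ (N * k) := by
          rw [pow_succ, Nat.mul_succ, Nat.add_comm, pow_add]; simp only [mul_assoc]
      _ = A := by rw [h, ih]

/-- Passing one `A` multiplies the exponent by `-N`, which a monoid cannot express; passing two
restores the sign. This is why even powers of `A` appear below. -/
theorem pow_mul_sq (h : B * A * A * (B * A) ^ N = A) (k : ℕ) :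
    (B * A) ^ k * (A * A) = A * A * (B * A) ^ (N * (N * k)) := by
  calc (B * A) ^ k * (A * A)
      = (B * A) ^ k * (A * ((B * A) ^ (N * k) * A * (B * A) ^ (N * (N * k)))) := by
        rw [pow_mul_mul_pow_eq h]
    _ = (B * A) ^ k * A * (B * A) ^ (N * k) * A * (B * A) ^ (N * (N * k)) := by
        simp only [mul_assoc]
    _ = _ := by rw [pow_mul_mul_pow_eq h]

theorem mul_pow_two_mul (h : B * A * A * (B * A) ^ N = A) (k : ℕ) :
    B * A * A ^ (2 * k) = A ^ (2 * k) * (B * A) ^ N ^ (2 * k) := by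
  induction k with
  | zero => simp
  | succ k ih =>
    have e : N ^ (2 * (k + 1)) = N * (N * N ^ (2 * k)) := by ring
    rw [e, Nat.mul_succ, pow_add, ← mul_assoc, ih, mul_assoc, pow_two, pow_mul_sq h]
    simp only [mul_assoc]

theorem exists_pow_mul_pow_succ (hN : 1 ≤ N) (h : B * A * A * (B * A) ^ N = A) (k : ℕ) :
    ∃ q : ℕ, (N + 1) * q + 1 = N ^ (2 * k) ∧
      B ^ (2 * k) * A ^ (2 * k + 1) = A * (B * A) ^ (N * q) := by
  induction k with
  | zero => exact ⟨0, by simp⟩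
  | succ k ih =>
    obtain ⟨q, hq, e⟩ := ih
    obtain ⟨d, rfl⟩ := Nat.exists_eq_add_of_le' hN
    -- With `N = d + 1`, this solves `(N+1)q' + 1 = N²((N+1)q + 1)`.
    refine ⟨(d + 1) * (d + 1) * q + d, ?_, ?_⟩
    · have : (d + 1) ^ (2 * (k + 1)) = (d + 1) * (d + 1) * (d + 1) ^ (2 * k) := by ring
      rw [this, ← hq]
      ring
    · have e₁ : (d + 1) * ((d + 1) * ((d + 1) * q + 1)) =
          (d + 1) + (d + 1) * ((d + 1) * (d + 1) * q + d) := by ring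
      have e₂ : A ^ (2 * (k + 1) + 1) = A ^ (2 * k + 1) * (A * A) := by
        rw [← pow_two, ← pow_add]; ring_nf
      have e₃ : B ^ (2 * (k + 1)) = B * (B * B ^ (2 * k)) := by
        rw [← pow_succ', ← pow_succ']; ring_nf
      calc B ^ (2 * (k + 1)) * A ^ (2 * (k + 1) + 1)
          = B * (B * (B ^ (2 * k) * A ^ (2 * k + 1))) * (A * A) := by
            rw [e₂, e₃]; simp only [mul_assoc]
        -- Moving this power past `A * A` yields exponent `N + N * q'`; the relation absorbs the
        -- first `N`.
        _ = B * ((B * A) ^ ((d + 1) * q + 1) * (A * A)) := by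
            rw [e, pow_succ']; simp only [mul_assoc]
        _ = B * A * A * (B * A) ^ (d + 1) *
              (B * A) ^ ((d + 1) * ((d + 1) * (d + 1) * q + d)) := by
            rw [pow_mul_sq h, e₁, pow_add]; simp only [mul_assoc]
        _ = _ := by rw [h]

/-- The exponent `N^(2k)` splits as `(Nq+1) + q`, and the `q` part cancels against `(B * A)^(N * q)`
across `A`. -/
theorem mul_pow_mul_pow_mul_pow_eq (hN : 1 ≤ N) (h : B * A * A * (B * A) ^ N = A) (k : ℕ) :
    B * A * A ^ (2 * k) * B ^ (2 * k) * A ^ (2 * k + 1) =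
      A ^ (2 * k) * B ^ (2 * k + 1) * A ^ (2 * k + 2) := by
  obtain ⟨q, hq, e⟩ := exists_pow_mul_pow_succ hN h k
  have e₁ : (N + 1) * q + 1 = (N * q + 1) + q := by ring
  calc B * A * A ^ (2 * k) * B ^ (2 * k) * A ^ (2 * k + 1)
      = A ^ (2 * k) * ((B * A) ^ (N * q + 1) * ((B * A) ^ q * A * (B * A) ^ (N * q))) := by
        rw [mul_pow_two_mul h, mul_assoc, e, ← hq, e₁, pow_add]; simp only [mul_assoc]
    _ = A ^ (2 * k) * (B * (A * (B * A) ^ (N * q)) * A) := by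
        rw [pow_mul_mul_pow_eq h, pow_succ']; simp only [mul_assoc]
    _ = _ := by
        rw [← e, pow_succ' B, pow_succ A (2 * k + 1)]; simp only [mul_assoc]

end Equality

/-- The left-hand side of a pair of equal words of `Π_N` that are exponentially far apart. -/
def farLeft (k : ℕ) : FreeMonoid Letter :=
  wb * wa * wa ^ (2 * k) * wb ^ (2 * k) * wa ^ (2 * k + 1)

/-- The right-hand side of a pair of equal words of `Π_N` that are exponentially far apart. -/
def farRight (k : ℕ) : FreeMonoid Letter :=
  wa ^ (2 * k) * wb ^ (2 * k + 1) * wa ^ (2 * k + 2)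

theorem eqIn_farLeft_farRight {N : ℕ} (hN : 1 ≤ N) (k : ℕ) :
    EqIn (piRel N) (farLeft k) (farRight k) := by
  have h : PresentedMonoid.mk (piRel N) (wb * wa * wa * (wb * wa) ^ N) =
      PresentedMonoid.mk (piRel N) wa := Quotient.sound (ConGen.Rel.of _ _ ⟨rfl, rfl⟩)
  simp only [map_mul, map_pow] at h
  simp only [EqIn, farLeft, farRight, map_mul, map_pow]
  exact mul_pow_mul_pow_mul_pow_eq hN h k

theorem length_pow_of {α : Type*} (x : α) (k : ℕ) : (FreeMonoid.of x ^ k).length = k := by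
  induction k with
  | zero => simp
  | succ k ih => rw [pow_succ, FreeMonoid.length_mul, ih, FreeMonoid.length_of]

theorem length_farLeft (k : ℕ) : (farLeft k).length = 6 * k + 3 := by
  simp only [farLeft, wa, wb, FreeMonoid.length_mul, length_pow_of, FreeMonoid.length_of]
  ring

theorem length_farRight (k : ℕ) : (farRight k).length = 6 * k + 3 := by
  simp only [farRight, wa, wb, FreeMonoid.length_mul, length_pow_of]
  ring

/-! ### A weight that one elementary transformation changes by at most 1 -/

section LowerBound

/-- The contribution of a letter `b` read at level `j` and position `s`. -/
noncomputable def cochain (N : ℕ) (j : ℤ) (s : ℚ) : ℚ :=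
  open Classical in if 0 ≤ j ∧ s ∈ Set.range ((↑) : ℤ → ℚ) then (-(N : ℚ)) ^ j else 0

/-- Reading a letter changes the level, the position and the accumulated weight. -/
noncomputable def readLetter (N : ℕ) (σ : ℤ × ℚ × ℚ) : Letter → ℤ × ℚ × ℚ
  | .a => (σ.1 - 1, σ.2.1, σ.2.2)
  | .b => (σ.1 + 1, σ.2.1 + (-(N : ℚ)) ^ σ.1, σ.2.2 + cochain N σ.1 σ.2.1)

/-- Reading a word from left to right. -/
noncomputable def readWord (N : ℕ) (w : FreeMonoid Letter) (σ : ℤ × ℚ × ℚ) : ℤ × ℚ × ℚ :=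
  w.toList.foldl (readLetter N) σ

variable {N : ℕ}

theorem readWord_one (σ : ℤ × ℚ × ℚ) : readWord N 1 σ = σ := rfl

theorem readWord_mul (u v : FreeMonoid Letter) (σ : ℤ × ℚ × ℚ) :
    readWord N (u * v) σ = readWord N v (readWord N u σ) := by
  simp [readWord, FreeMonoid.toList_mul]

theorem readWord_wa (j : ℤ) (s w : ℚ) : readWord N wa (j, s, w) = (j - 1, s, w) := rfl

theorem readWord_wb (j : ℤ) (s w : ℚ) :
    readWord N wb (j, s, w) = (j + 1, s + (-(N : ℚ)) ^ j, w + cochain N j s) := rfl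

theorem readWord_add_weight (u : FreeMonoid Letter) (j : ℤ) (s w d : ℚ) :
    readWord N u (j, s, w + d) =
      ((readWord N u (j, s, w)).1, (readWord N u (j, s, w)).2.1,
        (readWord N u (j, s, w)).2.2 + d) := by
  induction u using FreeMonoid.inductionOn' generalizing j s w with
  | one => rfl
  | of_mul x u ih =>
    rw [readWord_mul, readWord_mul]
    cases x
    · exact ih _ _ _
    · have := ih (j + 1) (s + (-(N : ℚ)) ^ j) (w + cochain N j s)
      rw [add_right_comm] at this
      exact this

theorem neg_zpow_mem_range {j : ℤ} (hj : 0 ≤ j) :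
    (-(N : ℚ)) ^ j ∈ Set.range ((↑) : ℤ → ℚ) := by
  lift j to ℕ using hj
  exact ⟨(-(N : ℤ)) ^ j, by simp⟩

theorem add_neg_zpow_mem_range_iff {i : ℤ} (hi : 0 ≤ i) (s : ℚ) :
    s + (-(N : ℚ)) ^ i ∈ Set.range ((↑) : ℤ → ℚ) ↔ s ∈ Set.range ((↑) : ℤ → ℚ) := by
  obtain ⟨m, hm⟩ := neg_zpow_mem_range (N := N) hi
  rw [← hm]
  constructor
  · rintro ⟨z, hz⟩
    exact ⟨z - m, by push_cast; linarith⟩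
  · rintro ⟨z, rfl⟩
    exact ⟨z + m, by push_cast; rfl⟩

/-- For `j < 0` both sides vanish; otherwise the shift is an integer. The relator needs a shift made
one level above the reading level, hence `i` separate from `j`. -/
theorem cochain_add {i : ℤ} (j : ℤ) (h : 0 ≤ j → 0 ≤ i) (s : ℚ) :
    cochain N j (s + (-(N : ℚ)) ^ i) = cochain N j s := by
  by_cases hj : 0 ≤ j
  · unfold cochain
    congr 1
    rw [add_neg_zpow_mem_range_iff (h hj)]
  · simp [cochain, hj]

theorem readWord_wb_wa_pow (i : ℕ) (j : ℤ) (s w : ℚ) :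
    readWord N ((wb * wa) ^ i) (j, s, w) =
      (j, s + i * (-(N : ℚ)) ^ j, w + i * cochain N j s) := by
  induction i generalizing s w with
  | zero => simp [readWord_one]
  | succ i ih =>
    rw [pow_succ', readWord_mul, readWord_mul, readWord_wb, readWord_wa, add_sub_cancel_right, ih,
      cochain_add j id]
    push_cast
    refine Prod.ext rfl (Prod.ext ?_ ?_) <;> simp only <;> ring

/-- The shifts cancel because `(-N)^j + N(-N)^(j-1) = 0`. At integer positions the weights cancel in
the same way for `j ≥ 1` and are all 0 for `j < 0`; at `j = 0` only the first `b` counts, with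
weight 1. -/
theorem readWord_relator (hN : 1 ≤ N) (j : ℤ) (s w : ℚ) :
    ∃ d : ℚ, |d| ≤ 1 ∧
      readWord N (wb * wa * wa * (wb * wa) ^ N) (j, s, w) = (j - 1, s, w + d) := by
  have hN' : (-(N : ℚ)) ≠ 0 := by
    rw [neg_ne_zero]; exact_mod_cast (by omega : N ≠ 0)
  have hz : (-(N : ℚ)) ^ j = -(N : ℚ) * (-(N : ℚ)) ^ (j - 1) := by
    rw [← zpow_one_add₀ hN']; ring_nf
  refine ⟨cochain N j s + N * cochain N (j - 1) s, ?_, ?_⟩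
  · simp only [cochain]
    by_cases hs : s ∈ Set.range ((↑) : ℤ → ℚ)
    · rcases lt_trichotomy j 0 with hj | rfl | hj
      · rw [if_neg (by omega), if_neg (by omega)]
        simp
      · simp [hs]
      · rw [if_pos ⟨by omega, hs⟩, if_pos ⟨by omega, hs⟩, hz]
        simp
    · simp [hs]
  · rw [readWord_mul, readWord_mul, readWord_mul, readWord_wb, readWord_wa, readWord_wa,
      add_sub_cancel_right, readWord_wb_wa_pow, cochain_add (j - 1) (fun h => by omega)]
    refine Prod.ext rfl (Prod.ext ?_ ?_)
    · simp only [hz]; ring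
    · simp only; ring

theorem abs_weight_sub_le_of_step (hN : 1 ≤ N) {u v : FreeMonoid Letter}
    (h : Step (piRel N) u v) (σ : ℤ × ℚ × ℚ) :
    |(readWord N u σ).2.2 - (readWord N v σ).2.2| ≤ 1 := by
  obtain ⟨p, q, l, r, hR, rfl, rfl⟩ := h
  simp only [readWord_mul]
  obtain ⟨j, s, w⟩ := readWord N p σ
  obtain ⟨d, hd, e⟩ := readWord_relator hN j s w
  rcases hR with ⟨rfl, rfl⟩ | ⟨rfl, rfl⟩
  -- The suffix is read from the same level and position on both sides, so it carries the
  -- discrepancy `d` along unchanged.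
  · rw [e, readWord_wa, readWord_add_weight]
    simpa using hd
  · rw [e, readWord_wa, readWord_add_weight]
    simpa using hd

theorem abs_weight_sub_le_of_derivation (hN : 1 ≤ N) {k : ℕ} {u v : FreeMonoid Letter}
    (h : Derivation (piRel N) k u v) (σ : ℤ × ℚ × ℚ) :
    |(readWord N u σ).2.2 - (readWord N v σ).2.2| ≤ k := by
  induction h with
  | refl u => simp
  | step h _ ih =>
    have := abs_sub_le_iff.1 (abs_weight_sub_le_of_step hN h σ)
    have := abs_sub_le_iff.1 ih
    push_cast
    rw [abs_sub_le_iff]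
    constructor <;> linarith

theorem readWord_wa_pow (i : ℕ) (j : ℤ) (s w : ℚ) :
    readWord N (wa ^ i) (j, s, w) = (j - i, s, w) := by
  induction i generalizing j with
  | zero => simp [readWord_one]
  | succ i ih =>
    rw [pow_succ', readWord_mul, readWord_wa, ih]
    push_cast
    rw [sub_sub, add_comm]

theorem weight_wa_pow (i : ℕ) (σ : ℤ × ℚ × ℚ) : (readWord N (wa ^ i) σ).2.2 = σ.2.2 := by
  obtain ⟨j, s, w⟩ := σ
  rw [readWord_wa_pow]

theorem weight_wb_pow_of_notMem (i : ℕ) {j : ℤ} (hj : 0 ≤ j) {s : ℚ}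
    (hs : s ∉ Set.range ((↑) : ℤ → ℚ)) (w : ℚ) :
    (readWord N (wb ^ i) (j, s, w)).2.2 = w := by
  induction i generalizing j s with
  | zero => rfl
  | succ i ih =>
    have e : cochain N j s = 0 := by simp [cochain, hs]
    rw [pow_succ', readWord_mul, readWord_wb, e, add_zero]
    exact ih (by omega) (by rwa [add_neg_zpow_mem_range_iff hj])

theorem inv_notMem_range (hN : 2 ≤ N) (m : ℤ) :
    (m : ℚ) + (-(N : ℚ)) ^ (-1 : ℤ) ∉ Set.range ((↑) : ℤ → ℚ) := by
  rintro ⟨z, hz⟩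
  have hN' : (N : ℚ) ≠ 0 := by exact_mod_cast (by omega : N ≠ 0)
  have h : ((m - z) * N : ℚ) = 1 := by
    rw [zpow_neg_one] at hz
    rw [hz]
    field_simp
    ring
  have h' : (m - z) * (N : ℤ) = 1 := by exact_mod_cast h
  have := Int.le_of_dvd one_pos (Dvd.intro_left _ h')
  omega

/-- The first `b` is weightless at level -1 and shifts by `-1/N`; later shifts are integers, so the
position never becomes integral again. -/
theorem weight_wb_pow_of_level_neg_one (hN : 2 ≤ N) (i : ℕ) (m : ℤ) (w : ℚ) :
    (readWord N (wb ^ i) (-1, m, w)).2.2 = w := by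
  cases i with
  | zero => rfl
  | succ i =>
    have e : cochain N (-1) m = 0 := by simp [cochain]
    rw [pow_succ', readWord_mul, readWord_wb, e, add_zero]
    exact weight_wb_pow_of_notMem i (by omega) (inv_notMem_range hN m) w

theorem weight_farLeft (hN : 2 ≤ N) {k : ℕ} (hk : 1 ≤ k) :
    (readWord N (farLeft k) (2 * k - 1, 0, 0)).2.2 = (-(N : ℚ)) ^ (2 * k - 1 : ℤ) := by
  have hj : (0 : ℤ) ≤ 2 * k - 1 := by omega
  obtain ⟨m, hm⟩ := neg_zpow_mem_range (N := N) hj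
  have e : cochain N (2 * k - 1) 0 = m := by
    rw [cochain, if_pos ⟨hj, 0, by simp⟩, hm]
  rw [farLeft, readWord_mul, weight_wa_pow, readWord_mul, readWord_mul, readWord_mul, readWord_wb,
    readWord_wa, readWord_wa_pow, e, ← hm, zero_add]
  have : (2 * (k : ℤ) - 1 + 1 - 1 - (2 * k : ℕ)) = -1 := by push_cast; ring
  rw [this, weight_wb_pow_of_level_neg_one hN]

theorem weight_farRight (hN : 2 ≤ N) (k : ℕ) :
    (readWord N (farRight k) (2 * k - 1, 0, 0)).2.2 = 0 := by
  rw [farRight, readWord_mul, weight_wa_pow, readWord_mul, readWord_wa_pow]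
  have : (2 * (k : ℤ) - 1 - (2 * k : ℕ)) = -1 := by push_cast; ring
  rw [this]
  exact_mod_cast weight_wb_pow_of_level_neg_one hN (2 * k + 1) 0 0

theorem pow_le_of_derivation (hN : 2 ≤ N) {k d : ℕ} (hk : 1 ≤ k)
    (h : Derivation (piRel N) d (farLeft k) (farRight k)) : N ^ (2 * k - 1) ≤ d := by
  have := abs_weight_sub_le_of_derivation (by omega) h (2 * k - 1, 0, 0)
  rw [weight_farLeft hN hk, weight_farRight hN, sub_zero, abs_zpow, abs_neg, Nat.abs_cast] at this
  have e : (2 * k - 1 : ℤ) = ((2 * k - 1 : ℕ) : ℤ) := by omega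
  rw [e, zpow_natCast] at this
  exact_mod_cast this

/-- The two words have total length `12n + 6`, at most `18n` for `n ≥ 1`. -/
theorem pow_le_dehnFunction (hN : 2 ≤ N) {n : ℕ} (hn : 1 ≤ n) :
    N ^ n ≤ dehnFunction (piRel N) (18 * n) := by
  have heq := eqIn_farLeft_farRight (N := N) (by omega) n
  have hd : Derivation (piRel N) (derivationDist (piRel N) (farLeft n) (farRight n))
      (farLeft n) (farRight n) :=
    Nat.sInf_mem ((eqIn_iff_exists_derivation _ _ _).1 heq)
  calc N ^ n ≤ N ^ (2 * n - 1) := Nat.pow_le_pow_right (by omega) (by omega)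
    _ ≤ derivationDist (piRel N) (farLeft n) (farRight n) := pow_le_of_derivation hN hn hd
    _ ≤ dehnFunction (piRel N) (18 * n) :=
      (isGreatest_dehnFunction _ _).2
        ⟨_, _, heq, by rw [length_farLeft, length_farRight]; omega, rfl⟩

end LowerBound

/-! ### Growth comparison and the Cain–Maltcev question -/

theorem growthLE_dehnFunction_piRel {N : ℕ} (hN : 2 ≤ N) {φ : ℕ → ℝ}
    (hφ : ∀ n, φ n ≤ (N : ℝ) ^ n) :
    GrowthLE φ (fun n => (dehnFunction (piRel N) n : ℝ)) := by
  refine ⟨18, fun n hn => ?_⟩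
  have h : (N : ℝ) ^ n ≤ dehnFunction (piRel N) (18 * n) := by
    exact_mod_cast pow_le_dehnFunction hN hn
  have := hφ n
  have : (0 : ℝ) ≤ n := n.cast_nonneg
  have : (0 : ℝ) ≤ (N : ℝ) ^ n := by positivity
  push_cast
  linarith

theorem monadicRel_eq_piRel_two : monadicRel (wa * wa * wb * wa * wb) = piRel 2 := by
  funext l r
  simp only [monadicRel, piRel, pow_two, mul_assoc]

theorem not_growthLE_sq_of_two_pow_le {ψ : ℕ → ℝ} {d : ℕ}
    (hψ : ∀ n : ℕ, 1 ≤ n → (2 : ℝ) ^ n ≤ ψ (d * n)) (hd : 1 ≤ d) :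
    ¬ GrowthLE ψ (fun n => (n : ℝ) ^ 2) := by
  rintro ⟨c, hc⟩
  set C : ℝ := c * (c * d) ^ 2 + c * d with hC
  have hlim : Filter.Tendsto (fun n : ℕ => (n : ℝ) ^ 2 / 2 ^ n) Filter.atTop (nhds 0) :=
    tendsto_pow_const_div_const_pow_of_one_lt 2 one_lt_two
  have hCpos : 0 ≤ C := by positivity
  have hev := hlim.eventually (gt_mem_nhds (show (0 : ℝ) < 1 / (C + 1) by positivity))
  obtain ⟨n, hn, hn1⟩ := (hev.and (Filter.eventually_ge_atTop 1)).exists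
  rw [div_lt_div_iff₀ (by positivity) (by positivity)] at hn
  have h₁ := hψ n hn1
  have h₂ := hc (d * n) (Nat.mul_pos hd hn1)
  push_cast at h₂
  have hn' : (1 : ℝ) ≤ n := by exact_mod_cast hn1
  have h₃ : (c : ℝ) * d * n ≤ c * d * n ^ 2 := by
    have : (n : ℝ) ≤ n ^ 2 := by nlinarith
    gcongr
  have h₄ : (0 : ℝ) ≤ (n : ℝ) ^ 2 := by positivity
  have h₅ : (n : ℝ) ^ 2 * (C + 1) =
      c * (c * (d * n)) ^ 2 + c * d * n ^ 2 + n ^ 2 := by rw [hC]; ring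
  linarith

end MonoidDehn

theorem theorem1 :
    (∀ N : ℕ, 2 ≤ N →
      MonoidDehn.GrowthLE (fun n : ℕ => (N : ℝ) ^ ((n : ℝ) / 4))
        (fun n : ℕ => (MonoidDehn.dehnFunction (MonoidDehn.piRel N) n : ℝ)) ∧
      MonoidDehn.GrowthLE (fun n : ℕ => (2 : ℝ) ^ n)
        (fun n : ℕ => (MonoidDehn.dehnFunction (MonoidDehn.piRel N) n : ℝ))) ∧
    ¬ ∀ U : FreeMonoid MonoidDehn.Letter,
      MonoidDehn.GrowthLE
        (fun n : ℕ => (MonoidDehn.dehnFunction (MonoidDehn.monadicRel U) n : ℝ))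
        (fun n : ℕ => (n : ℝ) ^ 2) := by
  refine ⟨fun N hN => ⟨?_, ?_⟩, fun h => ?_⟩
  · refine MonoidDehn.growthLE_dehnFunction_piRel hN fun n => ?_
    have hN1 : (1 : ℝ) ≤ N := by exact_mod_cast (by omega : 1 ≤ N)
    rw [← Real.rpow_natCast (N : ℝ) n]
    have : (0 : ℝ) ≤ n := n.cast_nonneg
    exact Real.rpow_le_rpow_of_exponent_le hN1 (by linarith)
  · refine MonoidDehn.growthLE_dehnFunction_piRel hN fun n => ?_
    have hN2 : (2 : ℝ) ≤ N := by exact_mod_cast hN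
    gcongr
  -- The counterexample is `U = aabab`, for which `bUa = baa(ba)^2`.
  · have h₂ := h (MonoidDehn.wa * MonoidDehn.wa * MonoidDehn.wb * MonoidDehn.wa * MonoidDehn.wb)
    rw [MonoidDehn.monadicRel_eq_piRel_two] at h₂
    refine MonoidDehn.not_growthLE_sq_of_two_pow_le (d := 18) (fun n hn => ?_) (by norm_num) h₂
    exact_mod_cast MonoidDehn.pow_le_dehnFunction le_rfl hn
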